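/- Let $\mu\ge 1$ be an integer, let $V_{i,1},V_{i,2}\ge 0$ $(1\le i\le\mu)$ be real amplitudes that are not all zero, and let $\sigma,E_s,N_0>0$. Let $\phi_{i,1},\phi_{i,2}$ be uniform on $[0,2\pi)$ and $X_i,Y_i\sim\mathcal N(0,\sigma^2)$ $(1\le i\le\mu)$, all these $4\mu$ random variables being mutually independent. In the multi-cluster two-wave (MTW) fading model the complex amplitude of the $i$-th cluster is $$Z_i=V_{i,1}e^{j\phi_{i,1}}+V_{i,2}e^{j\phi_{i,2}}+X_i+jY_i ,$$ the received power is $W=\sum_{i=1}^{\mu}|Z_i|^2$, and the received SNR is $\gamma=W E_s/N_0$, with mean $\overline\gamma=\mathbb E[\gamma]$. Put $$K=\frac{\sum_{i=1}^{\mu}(V_{i,1}^2+V_{i,2}^2)}{2\sigma^2\mu},\qquad \Delta_i=\frac{2V_{i,1}V_{i,2}}{\sum_{j=1}^{\mu}(V_{j,1}^2+V_{j,2}^2)} ,$$ and let $0\le N\le\mu$ be such that for each $i>N$ at least one of $V_{i,1},V_{i,2}$ is zero (for example, the clusters are numbered so that exactly the first $N$ contain two specular components). Then $\gamma$ has a probability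 density function with respect to Lebesgue measure. It vanishes for $x<0$, and for (almost every) $x\ge 0$ it is given by $$f_\gamma(x)=\frac{\mu}{\pi^N}\left(\frac{1+K}{\overline\gamma}\right)^{\frac{\mu+1}{2}}e^{-\mu K}\left(\frac{x}{K}\right)^{\frac{\mu-1}{2}}e^{-\mu\frac{1+K}{\overline\gamma}x}\int_0^\pi\!\!\cdots\!\int_0^\pi e^{-\mu K\sum_{i=1}^N\Delta_i\cos\theta_i}\Big(1+\sum_{i=1}^N\Delta_i\cos\theta_i\Big)^{\frac{1-\mu}{2}} I_{\mu-1}\!\left(2\mu\sqrt{\tfrac{1+K}{\overline\gamma}K\Big(1+\sum_{i=1}^N\Delta_i\cos\theta_i\Big)x}\right)d\theta_1\cdots d\theta_N ,$$ where $I_{\mu-1}(z)=\sum_{k\ge0}\frac{(z/2)^{2k+\mu-1}}{k!\,(k+\mu-1)!}$ is the modified Bessel function of the first kind of order $\mu-1$. The integrand is integrable over $[0,\pi]^N$ for every $x\ge 0$. -/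

import Mathlib

open MeasureTheory ProbabilityTheory
open scoped BigOperators

noncomputable section

namespace MTW

/-- Modified Bessel function of the first kind of integer order `n ≥ 0`,
`I_n(z) = ∑_k (z/2)^(2k+n) / (k! (k+n)!)`. -/
def besselI (n : ℕ) (z : ℝ) : ℝ :=
  ∑' k : ℕ, (z / 2) ^ (2 * k + n) / ((k.factorial : ℝ) * ((k + n).factorial : ℝ))

/-- The series defining `besselI` converges everywhere. -/
theorem summable_besselI (n : ℕ) (z : ℝ) :
    Summable fun k : ℕ => (z / 2) ^ (2 * k + n) / ((k.factorial : ℝ) * ((k + n).factorial : ℝ)) := by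
  have h := (Real.summable_pow_div_factorial ((z / 2) ^ 2)).norm.mul_left (‖(z / 2) ^ n‖)
  refine Summable.of_norm_bounded h fun k => ?_
  have h1 : (1 : ℝ) ≤ ((k + n).factorial : ℝ) := by exact_mod_cast Nat.succ_le_of_lt (Nat.factorial_pos _)
  have h2 : (0 : ℝ) < (k.factorial : ℝ) := by exact_mod_cast Nat.factorial_pos k
  rw [pow_add, pow_mul, norm_div, norm_mul, norm_div, mul_comm ‖((z / 2) ^ 2) ^ k‖, mul_div_assoc]
  refine mul_le_mul_of_nonneg_left ?_ (norm_nonneg _)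
  refine div_le_div_of_nonneg_left (norm_nonneg _) (norm_pos_iff.mpr h2.ne') ?_
  rw [norm_mul, Real.norm_of_nonneg (by linarith : (0 : ℝ) ≤ ((k + n).factorial : ℝ))]
  exact le_mul_of_one_le_right (norm_nonneg _) h1

variable {Ω : Type*} {μ : ℕ}

/-- The randomness of the multi-cluster two-wave fading channel with `μ` clusters: the phases
`φ i k` (`k = 0, 1`) of the two specular waves of cluster `i` are uniform on `[0, 2π)`, the in-phase
and quadrature components `X i`, `Y i` of the diffuse part of cluster `i` are `N(0, σ²)`, and all
these `4 μ` random variables are mutually independent. -/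
structure IsFading [MeasurableSpace Ω] (P : Measure Ω) (σ : ℝ)
    (φ : Fin μ → Fin 2 → Ω → ℝ) (X Y : Fin μ → Ω → ℝ) : Prop where
  phase_uniform : ∀ i k, pdf.IsUniform (φ i k) (Set.Ico 0 (2 * Real.pi)) P volume
  gaussian_X : ∀ i, HasLaw (X i) (gaussianReal 0 (σ ^ 2).toNNReal) P
  gaussian_Y : ∀ i, HasLaw (Y i) (gaussianReal 0 (σ ^ 2).toNNReal) P
  indep : iIndepFun (Sum.elim (fun p : Fin μ × Fin 2 => φ p.1 p.2) (Sum.elim X Y)) P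

/-- Complex baseband amplitude of the `i`-th cluster,
`Z_i = V_{i,1} exp(j φ_{i,1}) + V_{i,2} exp(j φ_{i,2}) + X_i + j Y_i`. -/
def clusterAmplitude (V : Fin μ → Fin 2 → ℝ) (φ : Fin μ → Fin 2 → Ω → ℝ) (X Y : Fin μ → Ω → ℝ)
    (i : Fin μ) (ω : Ω) : ℂ :=
  (V i 0 : ℂ) * Complex.exp (Complex.I * (φ i 0 ω : ℂ))
    + (V i 1 : ℂ) * Complex.exp (Complex.I * (φ i 1 ω : ℂ))
    + (X i ω : ℂ) + Complex.I * (Y i ω : ℂ)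

/-- Total received power `W = ∑ i, |Z_i|²`. -/
def power (V : Fin μ → Fin 2 → ℝ) (φ : Fin μ → Fin 2 → Ω → ℝ) (X Y : Fin μ → Ω → ℝ) (ω : Ω) : ℝ :=
  ∑ i, ‖clusterAmplitude V φ X Y i ω‖ ^ 2

/-- Received signal-to-noise ratio `γ = W E_s / N_0`. -/
def snr (V : Fin μ → Fin 2 → ℝ) (φ : Fin μ → Fin 2 → Ω → ℝ) (X Y : Fin μ → Ω → ℝ)
    (Es N0 : ℝ) (ω : Ω) : ℝ :=
  power V φ X Y ω * Es / N0

/-- Total average power of the specular components. -/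
def specularPower (V : Fin μ → Fin 2 → ℝ) : ℝ :=
  ∑ i, ((V i 0) ^ 2 + (V i 1) ^ 2)

/-- Ratio `K` of the specular power to the diffuse power `2 σ² μ`. -/
def paramK (V : Fin μ → Fin 2 → ℝ) (σ : ℝ) : ℝ :=
  specularPower V / (2 * σ ^ 2 * μ)

/-- The parameter `Δ_i = 2 V_{i,1} V_{i,2} / ∑ j, (V_{j,1}² + V_{j,2}²)`. -/
def paramΔ (V : Fin μ → Fin 2 → ℝ) (i : Fin μ) : ℝ :=
  2 * V i 0 * V i 1 / specularPower V

/-- `1 + ∑_{i ≤ N} Δ_i cos θ_i`. -/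
def phaseFactor {N : ℕ} (Δ : Fin N → ℝ) (θ : Fin N → ℝ) : ℝ :=
  1 + ∑ i, Δ i * Real.cos (θ i)

/-- The integrand of the density formula, as a function of `θ ∈ [0, π]^N`; `g` is the
average SNR. -/
def pdfIntegrand (μ : ℕ) (K g : ℝ) {N : ℕ} (Δ : Fin N → ℝ) (x : ℝ) (θ : Fin N → ℝ) : ℝ :=
  Real.exp (-((μ : ℝ) * K * ∑ i, Δ i * Real.cos (θ i)))
    * phaseFactor Δ θ ^ ((1 - (μ : ℝ)) / 2)
    * besselI (μ - 1) (2 * (μ : ℝ) * √((1 + K) / g * K * phaseFactor Δ θ * x))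

/-- The density formula for arguments `x ≥ 0`: an `N`-fold integral over `[0, π]^N`. -/
def pdfFormula (μ : ℕ) (K g : ℝ) {N : ℕ} (Δ : Fin N → ℝ) (x : ℝ) : ℝ :=
  (μ : ℝ) / Real.pi ^ N * ((1 + K) / g) ^ (((μ : ℝ) + 1) / 2) * Real.exp (-((μ : ℝ) * K))
    * (x / K) ^ (((μ : ℝ) - 1) / 2) * Real.exp (-((μ : ℝ) * ((1 + K) / g) * x))
    * ∫ θ in Set.Icc (0 : Fin N → ℝ) (fun _ => Real.pi), pdfIntegrand μ K g Δ x θ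

end MTW

end

/-! The law of `γ` is identified through its moment generating function on a half-line `t < r`, with
no convolution of densities.

Given the phases, a cluster is a planar Gaussian shifted by a vector of squared length `a² + b² +
2ab cos(φ₁ - φ₂)`. With `q = 1 - 2tσ²`, its power has conditional MGF `q⁻¹ exp(t(a² + b² + 2ab
cos(φ₁ - φ₂)) / q)`. The phase difference is uniform modulo `2π`, so its cosine may be replaced by
`cos θ` with `θ` uniform on `[0, π]`. Independence multiplies the clusters, the exponents add, and
the MGF of the power becomes the average over `[0, π]^N` of `q^(-μ) exp(t S Λ(θ) / q)`, where `S` is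
the specular power and `Λ` the phase factor (`prod_clusterMGF`).

For fixed `θ` this is the MGF of a scaled noncentral chi-squared law with `2μ` degrees of freedom: a
mixture of gamma laws of shape `k + μ`, with `k` Poisson of mean `μKΛ(θ)`
(`lintegral_exp_mul_mixtureDensity`). By Tonelli the averaged mixture density has the MGF of `γ`,
and analytic continuation to the imaginary axis turns this into equality of laws
(`map_eq_map_of_mgf_eq_of_lt`).

Summing the mixture gives the series of `I_{μ-1}`. The gamma rate is `r = 1/(2σ²Es/N0)`, and the
mean of `γ` shows that `r = μ(1+K)/γ̄`, which yields the stated parameters. -/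

namespace MTW

/-! ### Uniqueness from the MGF on a half-line, and the noncentral Gaussian square -/

/-- Two random variables whose moment generating functions are finite and agree on `(-∞, a)` for
some `a > 0` have the same law. -/
theorem map_eq_map_of_mgf_eq_of_lt {Ω Ω' : Type*} [MeasurableSpace Ω] [MeasurableSpace Ω']
    {P : Measure Ω} {P' : Measure Ω'} [IsFiniteMeasure P] [IsFiniteMeasure P']
    {X : Ω → ℝ} {Y : Ω' → ℝ} (hX : AEMeasurable X P) (hY : AEMeasurable Y P')
    {a : ℝ} (ha : 0 < a) (hXi : Set.Iio a ⊆ integrableExpSet X P)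
    (hYi : Set.Iio a ⊆ integrableExpSet Y P') (h : ∀ t < a, mgf X P t = mgf Y P' t) :
    P.map X = P'.map Y := by
  have hXa : AnalyticOnNhd ℂ (complexMGF X P) {z | z.re ∈ Set.Iio a} :=
    analyticOnNhd_complexMGF.mono fun z hz => interior_maximal hXi isOpen_Iio hz
  have hYa : AnalyticOnNhd ℂ (complexMGF Y P') {z | z.re ∈ Set.Iio a} :=
    analyticOnNhd_complexMGF.mono fun z hz => interior_maximal hYi isOpen_Iio hz
  have hEq : Set.EqOn (complexMGF X P) (complexMGF Y P') {z | z.re ∈ Set.Iio a} := by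
    refine AnalyticOnNhd.eqOn_of_preconnected_of_frequently_eq hXa hYa
      ((convex_Iio a).linear_preimage Complex.reLm).isPreconnected
      (z₀ := ((0 : ℝ) : ℂ)) (by simpa using ha) ?_
    -- Agreement on real points accumulating at `0` suffices for the identity theorem on the
    -- connected half-plane.
    have h_real : ∃ᶠ (x : ℝ) in nhdsWithin 0 {0}ᶜ, complexMGF X P x = complexMGF Y P' x := by
      refine Filter.Eventually.frequently ?_
      filter_upwards [mem_nhdsWithin_of_mem_nhds (Iio_mem_nhds ha)] with y hy
      rw [complexMGF_ofReal, complexMGF_ofReal, h y hy]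
    rw [Filter.frequently_iff_seq_forall] at h_real ⊢
    obtain ⟨xs, hx_tendsto, hx_eq⟩ := h_real
    refine ⟨fun n ↦ xs n, ?_, fun n ↦ ?_⟩
    · rw [tendsto_nhdsWithin_iff] at hx_tendsto ⊢
      constructor
      · exact (Complex.continuous_ofReal.tendsto _).comp hx_tendsto.1
      · simpa using hx_tendsto.2
    · simp [hx_eq]
  refine Measure.ext_of_charFun (funext fun t => ?_)
  -- The characteristic function is the complex MGF on the imaginary axis, which lies in the
  -- half-plane because `0 < a`.
  rw [← complexMGF_mul_I hX, ← complexMGF_mul_I hY]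
  exact hEq (by simpa using ha)

/-- Moment generating function of a noncentral Gaussian square. -/
theorem lintegral_exp_mul_sq_gaussianReal {σ t : ℝ} (hσ : 0 < σ) (ht : 0 < 1 - 2 * t * σ ^ 2)
    (a : ℝ) :
    ∫⁻ x, ENNReal.ofReal (Real.exp (t * (a + x) ^ 2)) ∂(gaussianReal 0 (σ ^ 2).toNNReal) =
      ENNReal.ofReal ((√(1 - 2 * t * σ ^ 2))⁻¹ * Real.exp (t * a ^ 2 / (1 - 2 * t * σ ^ 2))) := by
  have hv : (σ ^ 2).toNNReal ≠ 0 := by simp [hσ.ne']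
  set q := 1 - 2 * t * σ ^ 2 with hq
  have hw0 : 0 < σ ^ 2 / q := by positivity
  have hw : (σ ^ 2 / q).toNNReal ≠ 0 := by simpa using hw0
  rw [gaussianReal_of_var_ne_zero _ hv, lintegral_withDensity_eq_lintegral_mul _
    (measurable_gaussianPDF _ _) (by fun_prop)]
  -- Completing the square: the tilted Gaussian density is a multiple of one with mean `2taσ²/q` and
  -- variance `σ²/q`, which integrates to `1`.
  have key : ∀ x, (gaussianPDF 0 (σ ^ 2).toNNReal *
      fun x => ENNReal.ofReal (Real.exp (t * (a + x) ^ 2))) x =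
      ENNReal.ofReal ((√q)⁻¹ * Real.exp (t * a ^ 2 / q)) *
        gaussianPDF (2 * t * a * σ ^ 2 / q) (σ ^ 2 / q).toNNReal x := by
    intro x
    rw [Pi.mul_apply, gaussianPDF, gaussianPDF, ← ENNReal.ofReal_mul (gaussianPDFReal_nonneg _ _ _),
      ← ENNReal.ofReal_mul (by positivity)]
    congr 1
    rw [gaussianPDFReal, gaussianPDFReal, Real.coe_toNNReal _ (by positivity),
      Real.coe_toNNReal _ hw0.le, mul_assoc, ← Real.exp_add]
    have h1 : √(2 * Real.pi * (σ ^ 2 / q)) = √(2 * Real.pi * σ ^ 2) / √q := by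
      rw [← mul_div_assoc, Real.sqrt_div (by positivity)]
    have h2 : -(x - 0) ^ 2 / (2 * σ ^ 2) + t * (a + x) ^ 2 = t * a ^ 2 / q +
        -(x - 2 * t * a * σ ^ 2 / q) ^ 2 / (2 * (σ ^ 2 / q)) := by
      field_simp
      rw [hq]; ring
    rw [h1, h2, Real.exp_add]
    have : √q ≠ 0 := (Real.sqrt_pos.2 ht).ne'
    field_simp
  simp_rw [key]
  rw [lintegral_const_mul _ (measurable_gaussianPDF _ _), lintegral_gaussianPDF_eq_one _ hw, mul_one]

/-! ### Uniform phases -/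

/-- The uniform law on `[0, 2π)`. -/
noncomputable def uniformPhase : Measure ℝ := cond volume (Set.Ico 0 (2 * Real.pi))

instance : IsProbabilityMeasure uniformPhase := by
  refine cond_isProbabilityMeasure_of_finite ?_ ?_ <;>
    simp [Real.pi_pos, ENNReal.mul_eq_top]

theorem integral_uniformPhase (f : ℝ → ℝ) :
    ∫ x, f x ∂uniformPhase = (2 * Real.pi)⁻¹ * ∫ x in (0 : ℝ)..(2 * Real.pi), f x := by
  rw [uniformPhase, ProbabilityTheory.cond, integral_smul_measure,
    intervalIntegral.integral_of_le (by positivity), integral_Ico_eq_integral_Ioo,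
    integral_Ioc_eq_integral_Ioo]
  simp [Real.pi_pos.le]

theorem integrable_uniformPhase {f : ℝ → ℝ} (hf : Continuous f) : Integrable f uniformPhase := by
  refine Integrable.smul_measure ?_ (by simp [Real.pi_pos])
  exact (hf.integrableOn_Icc (a := 0) (b := 2 * Real.pi)).mono_set Set.Ico_subset_Icc_self

theorem integral_comp_cos_two_pi {h : ℝ → ℝ} (hh : Continuous h) :
    ∫ x in (0 : ℝ)..(2 * Real.pi), h (Real.cos x) =
      2 * ∫ x in Set.Icc 0 Real.pi, h (Real.cos x) := by
  have hc : Continuous fun x => h (Real.cos x) := hh.comp Real.continuous_cos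
  rw [← intervalIntegral.integral_add_adjacent_intervals (b := Real.pi)
    (hc.intervalIntegrable _ _) (hc.intervalIntegrable _ _), integral_Icc_eq_integral_Ioc,
    ← intervalIntegral.integral_of_le Real.pi_pos.le]
  have := intervalIntegral.integral_comp_sub_left (a := 0) (b := Real.pi)
    (fun x => h (Real.cos x)) (2 * Real.pi)
  simp only [Real.cos_two_pi_sub, sub_zero] at this
  rw [this, show 2 * Real.pi - Real.pi = Real.pi by ring]
  ring

/-- The cosine of the difference of two independent uniform phases is distributed as the cosine of
a uniform angle in `[0, π]`. -/
theorem lintegral_cos_sub_uniformPhase {h : ℝ → ℝ} (hh : Continuous h) (h0 : ∀ x, 0 ≤ h x) :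
    ∫⁻ p, ENNReal.ofReal (h (Real.cos (p.1 - p.2))) ∂(uniformPhase.prod uniformPhase) =
      ENNReal.ofReal (Real.pi⁻¹ * ∫ x in Set.Icc 0 Real.pi, h (Real.cos x)) := by
  rw [lintegral_prod_symm _ (by fun_prop)]
  have : ∀ y : ℝ, ∫⁻ x, ENNReal.ofReal (h (Real.cos (x - y))) ∂uniformPhase =
      ENNReal.ofReal (Real.pi⁻¹ * ∫ x in Set.Icc 0 Real.pi, h (Real.cos x)) := by
    intro y
    rw [← ofReal_integral_eq_lintegral_ofReal (integrable_uniformPhase (by fun_prop))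
      (ae_of_all _ fun x => h0 _), integral_uniformPhase,
      intervalIntegral.integral_comp_sub_right (fun x => h (Real.cos x))]
    -- Periodicity absorbs the second phase, so the inner integral does not depend on `y`.
    have hp : Function.Periodic (fun x => h (Real.cos x)) (2 * Real.pi) := fun x => by
      simp
    have := hp.intervalIntegral_add_eq (-y) 0
    rw [zero_sub, sub_eq_neg_add, this, zero_add, integral_comp_cos_two_pi hh]
    congr 1
    field_simp
  simp [this]

/-! ### The MGF of one cluster -/

variable {Ω : Type*} {μ : ℕ}

theorem norm_sq_clusterAmplitude (V : Fin μ → Fin 2 → ℝ) (φ : Fin μ → Fin 2 → Ω → ℝ)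
    (X Y : Fin μ → Ω → ℝ) (i : Fin μ) (ω : Ω) :
    ‖clusterAmplitude V φ X Y i ω‖ ^ 2 =
      (V i 0 * Real.cos (φ i 0 ω) + V i 1 * Real.cos (φ i 1 ω) + X i ω) ^ 2 +
        (V i 0 * Real.sin (φ i 0 ω) + V i 1 * Real.sin (φ i 1 ω) + Y i ω) ^ 2 := by
  rw [← Complex.normSq_eq_norm_sq, Complex.normSq_apply, clusterAmplitude]
  simp only [mul_comm Complex.I, Complex.exp_mul_I, ← Complex.ofReal_cos, ← Complex.ofReal_sin,
    Complex.add_re, Complex.add_im, Complex.mul_re, Complex.mul_im, Complex.ofReal_re,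
    Complex.ofReal_im, Complex.I_re, Complex.I_im]
  ring

/-- Conditional moment generating function of a cluster power, given its specular component. -/
theorem lintegral_exp_mul_sq_add_sq {σ t : ℝ} (hσ : 0 < σ) (ht : 0 < 1 - 2 * t * σ ^ 2)
    (a b : ℝ) :
    ∫⁻ z, ENNReal.ofReal (Real.exp (t * ((a + z.1) ^ 2 + (b + z.2) ^ 2)))
        ∂((gaussianReal 0 (σ ^ 2).toNNReal).prod (gaussianReal 0 (σ ^ 2).toNNReal)) =
      ENNReal.ofReal ((1 - 2 * t * σ ^ 2)⁻¹ *
        Real.exp (t * (a ^ 2 + b ^ 2) / (1 - 2 * t * σ ^ 2))) := by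
  simp_rw [mul_add, Real.exp_add, ENNReal.ofReal_mul (Real.exp_nonneg _)]
  rw [lintegral_prod_mul (f := fun x => ENNReal.ofReal (Real.exp (t * (a + x) ^ 2)))
    (g := fun x => ENNReal.ofReal (Real.exp (t * (b + x) ^ 2))) (by fun_prop) (by fun_prop),
    lintegral_exp_mul_sq_gaussianReal hσ ht, lintegral_exp_mul_sq_gaussianReal hσ ht,
    ← ENNReal.ofReal_mul (by positivity), mul_mul_mul_comm, ← Real.exp_add, ← mul_inv,
    Real.mul_self_sqrt ht.le, add_div]

/-- Moment generating function of the power of a cluster with specular amplitudes `a`, `b`, as an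
average over the phase difference. -/
noncomputable def clusterMGF (σ a b t : ℝ) : ℝ :=
  (1 - 2 * t * σ ^ 2)⁻¹ * Real.exp (t * (a ^ 2 + b ^ 2) / (1 - 2 * t * σ ^ 2)) *
    (Real.pi⁻¹ * ∫ x in Set.Icc 0 Real.pi,
      Real.exp (2 * t * a * b / (1 - 2 * t * σ ^ 2) * Real.cos x))

/-- The Gaussian part is integrated first; what remains depends on the phases only through the
cosine of their difference. -/
theorem lintegral_cluster {σ t : ℝ} (hσ : 0 < σ) (ht : 0 < 1 - 2 * t * σ ^ 2) (a b : ℝ) :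
    ∫⁻ z, ENNReal.ofReal (Real.exp (t *
        ((a * Real.cos z.1.1 + b * Real.cos z.1.2 + z.2.1) ^ 2 +
          (a * Real.sin z.1.1 + b * Real.sin z.1.2 + z.2.2) ^ 2)))
        ∂((uniformPhase.prod uniformPhase).prod
          ((gaussianReal 0 (σ ^ 2).toNNReal).prod (gaussianReal 0 (σ ^ 2).toNNReal))) =
      ENNReal.ofReal (clusterMGF σ a b t) := by
  rw [lintegral_prod _ (by fun_prop)]
  simp_rw [lintegral_exp_mul_sq_add_sq hσ ht]
  have key : ∀ p : ℝ × ℝ, t * ((a * Real.cos p.1 + b * Real.cos p.2) ^ 2 +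
      (a * Real.sin p.1 + b * Real.sin p.2) ^ 2) / (1 - 2 * t * σ ^ 2) =
      t * (a ^ 2 + b ^ 2) / (1 - 2 * t * σ ^ 2) +
        2 * t * a * b / (1 - 2 * t * σ ^ 2) * Real.cos (p.1 - p.2) := by
    intro p
    have h1 := Real.sin_sq_add_cos_sq p.1
    have h2 := Real.sin_sq_add_cos_sq p.2
    rw [Real.cos_sub]
    linear_combination (t / (1 - 2 * t * σ ^ 2)) * (a ^ 2 * h1 + b ^ 2 * h2)
  simp_rw [key, Real.exp_add, ← mul_assoc]
  have hn : 0 ≤ (1 - 2 * t * σ ^ 2)⁻¹ * Real.exp (t * (a ^ 2 + b ^ 2) / (1 - 2 * t * σ ^ 2)) := by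
    positivity
  simp_rw [ENNReal.ofReal_mul hn]
  rw [lintegral_const_mul _ (by fun_prop), lintegral_cos_sub_uniformPhase
    (h := fun y => Real.exp (2 * t * a * b / (1 - 2 * t * σ ^ 2) * y)) (by fun_prop)
    (fun _ => Real.exp_nonneg _), ← ENNReal.ofReal_mul hn, clusterMGF]

/-! ### From the fading model to the MGF of the power -/

variable [MeasurableSpace Ω] {P : Measure Ω} {σ : ℝ} {φ : Fin μ → Fin 2 → Ω → ℝ}
  {X Y : Fin μ → Ω → ℝ}

theorem IsFading.hasLaw_phase (h : IsFading P σ φ X Y) (i : Fin μ) (k : Fin 2) :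
    HasLaw (φ i k) uniformPhase P where
  aemeasurable := (h.phase_uniform i k).aemeasurable (by simp [Real.pi_pos])
    (by simp [ENNReal.mul_eq_top])
  map_eq := h.phase_uniform i k

theorem IsFading.aemeasurable (h : IsFading P σ φ X Y) (j : Fin μ × Fin 2 ⊕ (Fin μ ⊕ Fin μ)) :
    AEMeasurable
      (Sum.elim (fun p : Fin μ × Fin 2 => φ p.1 p.2) (Sum.elim X Y) j) P := by
  rcases j with p | i | i
  · exact (h.hasLaw_phase p.1 p.2).aemeasurable
  · exact (h.gaussian_X i).aemeasurable
  · exact (h.gaussian_Y i).aemeasurable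

/-- A nonintegrable function has Bochner integral `0`, so a strictly positive value certifies
integrability. -/
theorem integrable_exp_and_mgf_of_lintegral {Z : Ω → ℝ} (hZ : AEMeasurable Z P) {t m : ℝ}
    (hm : 0 < m) (h : ∫⁻ ω, ENNReal.ofReal (Real.exp (t * Z ω)) ∂P = ENNReal.ofReal m) :
    t ∈ integrableExpSet Z P ∧ mgf Z P t = m := by
  have hmeas : AEStronglyMeasurable (fun ω => Real.exp (t * Z ω)) P :=
    AEMeasurable.aestronglyMeasurable (by fun_prop)
  have hmgf : mgf Z P t = m := by
    rw [mgf, integral_eq_lintegral_of_nonneg_ae (ae_of_all _ fun _ => Real.exp_nonneg _) hmeas, h,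
      ENNReal.toReal_ofReal hm.le]
  refine ⟨?_, hmgf⟩
  by_contra hni
  exact hm.ne' (hmgf.symm.trans (integral_undef hni))

variable [IsProbabilityMeasure P]

theorem IsFading.hasLaw_cluster (h : IsFading P σ φ X Y) (i : Fin μ) :
    HasLaw (fun ω => ((φ i 0 ω, φ i 1 ω), (X i ω, Y i ω)))
      ((uniformPhase.prod uniformPhase).prod
        ((gaussianReal 0 (σ ^ 2).toNNReal).prod (gaussianReal 0 (σ ^ 2).toNNReal))) P := by
  have h1 : HasLaw (fun ω => (φ i 0 ω, φ i 1 ω)) (uniformPhase.prod uniformPhase) P := by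
    rw [← indepFun_iff_hasLaw_prodMk_prod (h.hasLaw_phase i 0) (h.hasLaw_phase i 1)]
    exact h.indep.indepFun (i := Sum.inl (i, 0)) (j := Sum.inl (i, 1)) (by simp)
  have h2 : HasLaw (fun ω => (X i ω, Y i ω))
      ((gaussianReal 0 (σ ^ 2).toNNReal).prod (gaussianReal 0 (σ ^ 2).toNNReal)) P := by
    rw [← indepFun_iff_hasLaw_prodMk_prod (h.gaussian_X i) (h.gaussian_Y i)]
    exact h.indep.indepFun (i := Sum.inr (Sum.inl i)) (j := Sum.inr (Sum.inr i)) (by simp)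
  rw [← indepFun_iff_hasLaw_prodMk_prod h1 h2]
  exact h.indep.indepFun_prodMk_prodMk₀ h.aemeasurable (Sum.inl (i, 0)) (Sum.inl (i, 1))
    (Sum.inr (Sum.inl i)) (Sum.inr (Sum.inr i)) (by simp) (by simp) (by simp) (by simp)

theorem IsFading.lintegral_exp_cluster (h : IsFading P σ φ X Y) (hσ : 0 < σ) {t : ℝ}
    (ht : 0 < 1 - 2 * t * σ ^ 2) (V : Fin μ → Fin 2 → ℝ) (i : Fin μ) :
    ∫⁻ ω, ENNReal.ofReal (Real.exp (t * ‖clusterAmplitude V φ X Y i ω‖ ^ 2)) ∂P =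
      ENNReal.ofReal (clusterMGF σ (V i 0) (V i 1) t) := by
  rw [← lintegral_cluster hσ ht, ← (h.hasLaw_cluster i).lintegral_comp (by fun_prop)]
  simp_rw [norm_sq_clusterAmplitude]

/-- A sum of functions of disjoint blocks of independent variables has the product of the
moment generating functions. -/
theorem mgf_sum_blocks {ι κ : Type*} {U : ι → Ω → ℝ}
    (hU : iIndepFun U P) (hm : ∀ i, AEMeasurable (U i) P) (T : κ → Finset ι)
    (hT : Pairwise (fun i j => Disjoint (T i) (T j)))
    (F : ∀ i, (T i → ℝ) → ℝ) (hF : ∀ i, Measurable (F i)) (t : ℝ) (s : Finset κ) :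
    mgf (∑ i ∈ s, fun ω => F i (fun j => U j ω)) P t =
      ∏ i ∈ s, mgf (fun ω => F i (fun j => U j ω)) P t := by
  classical
  have hQ : ∀ i, AEMeasurable (fun ω => F i (fun j => U j ω)) P := fun i =>
    (hF i).comp_aemeasurable (aemeasurable_pi_lambda _ fun j => hm j)
  induction s using Finset.induction_on with
  | empty => simp
  | insert i s hi ih =>
    rw [Finset.sum_insert hi, Finset.prod_insert hi, ← ih]
    refine IndepFun.mgf_add' ?_ (hQ i).aestronglyMeasurable
      (Finset.aemeasurable_sum _ fun j _ => hQ j).aestronglyMeasurable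
    have hd : Disjoint (T i) (s.biUnion T) := by
      rw [Finset.disjoint_biUnion_right]
      exact fun j hj => hT (fun e => hi (e ▸ hj))
    have := hU.indepFun_finset₀ _ _ hd hm
    -- The remaining sum is a function of the variables in the union of the other blocks, which is
    -- disjoint from block `i`.
    have key := this.comp (φ := F i)
      (ψ := fun u => ∑ j : s, F j fun l => u ⟨l, Finset.mem_biUnion.2 ⟨j, j.2, l.2⟩⟩) (hF i)
      (by
        refine Finset.measurable_sum _ fun j _ => (hF j).comp ?_
        fun_prop)
    convert key using 1
    · rfl
    rw [← Finset.sum_coe_sort s]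
    ext ω
    simp [Function.comp]

/-- Strict positivity is what later yields integrability of the exponentials, since a divergent
Bochner integral would be `0`. -/
theorem clusterMGF_pos {t : ℝ} (ht : 0 < 1 - 2 * t * σ ^ 2) (a b : ℝ) :
    0 < clusterMGF σ a b t := by
  have : 0 < ∫ x in Set.Icc 0 Real.pi,
      Real.exp (2 * t * a * b / (1 - 2 * t * σ ^ 2) * Real.cos x) := by
    rw [integral_Icc_eq_integral_Ioc, ← intervalIntegral.integral_of_le Real.pi_pos.le]
    exact intervalIntegral.intervalIntegral_pos_of_pos
      (Continuous.intervalIntegrable (by fun_prop) _ _) (fun _ => Real.exp_pos _) Real.pi_pos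
  rw [clusterMGF]
  have := Real.pi_pos
  positivity

theorem IsFading.mgf_power (h : IsFading P σ φ X Y) (hσ : 0 < σ) {t : ℝ}
    (ht : 0 < 1 - 2 * t * σ ^ 2) (V : Fin μ → Fin 2 → ℝ) :
    mgf (power V φ X Y) P t = ∏ i, clusterMGF σ (V i 0) (V i 1) t := by
  have hcl : ∀ i, mgf (fun ω => ‖clusterAmplitude V φ X Y i ω‖ ^ 2) P t =
      clusterMGF σ (V i 0) (V i 1) t := by
    intro i
    rw [mgf, integral_eq_lintegral_of_nonneg_ae (ae_of_all _ fun _ => Real.exp_nonneg _),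
      h.lintegral_exp_cluster hσ ht, ENNReal.toReal_ofReal (clusterMGF_pos ht _ _).le]
    have := (h.hasLaw_cluster i).aemeasurable
    simp_rw [norm_sq_clusterAmplitude]
    have h0 := (h.hasLaw_phase i 0).aemeasurable
    have h1 := (h.hasLaw_phase i 1).aemeasurable
    have h2 := (h.gaussian_X i).aemeasurable
    have h3 := (h.gaussian_Y i).aemeasurable
    exact AEMeasurable.aestronglyMeasurable (by fun_prop)
  let T : Fin μ → Finset (Fin μ × Fin 2 ⊕ (Fin μ ⊕ Fin μ)) := fun i =>
    {Sum.inl (i, 0), Sum.inl (i, 1), Sum.inr (Sum.inl i), Sum.inr (Sum.inr i)}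
  let F : ∀ i, (T i → ℝ) → ℝ := fun i u =>
    (V i 0 * Real.cos (u ⟨Sum.inl (i, 0), by simp [T]⟩) +
      V i 1 * Real.cos (u ⟨Sum.inl (i, 1), by simp [T]⟩) +
        u ⟨Sum.inr (Sum.inl i), by simp [T]⟩) ^ 2 +
    (V i 0 * Real.sin (u ⟨Sum.inl (i, 0), by simp [T]⟩) +
      V i 1 * Real.sin (u ⟨Sum.inl (i, 1), by simp [T]⟩) +
        u ⟨Sum.inr (Sum.inr i), by simp [T]⟩) ^ 2
  have hT : Pairwise (fun i j => Disjoint (T i) (T j)) := by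
    intro i j hij
    simp [T, hij.symm]
  have := mgf_sum_blocks h.indep h.aemeasurable T hT F (fun i => by fun_prop) t Finset.univ
  simp_rw [← hcl]
  convert this using 2
  · ext ω
    simp [power, F, norm_sq_clusterAmplitude]
  · congr 1
    ext ω
    simp [F, norm_sq_clusterAmplitude]

/-! ### The mean power -/

theorem integral_cos_uniformPhase : ∫ x, Real.cos x ∂uniformPhase = 0 := by
  simp [integral_uniformPhase]

theorem integral_sin_uniformPhase : ∫ x, Real.sin x ∂uniformPhase = 0 := by
  simp [integral_uniformPhase]

/-- After expanding the squares, every cross term is a product of independent centred factors and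
drops out. -/
theorem IsFading.integral_cluster (h : IsFading P σ φ X Y) (V : Fin μ → Fin 2 → ℝ)
    (i : Fin μ) :
    Integrable (fun ω => ‖clusterAmplitude V φ X Y i ω‖ ^ 2) P ∧
      ∫ ω, ‖clusterAmplitude V φ X Y i ω‖ ^ 2 ∂P =
        (V i 0) ^ 2 + (V i 1) ^ 2 + 2 * σ ^ 2 := by
  have add : ∀ {f g : Ω → ℝ} {m n : ℝ}, (Integrable f P ∧ ∫ ω, f ω ∂P = m) →
      (Integrable g P ∧ ∫ ω, g ω ∂P = n) →
      (Integrable (fun ω => f ω + g ω) P ∧ ∫ ω, f ω + g ω ∂P = m + n) :=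
    fun hf hg => ⟨hf.1.add hg.1, by rw [integral_add hf.1 hg.1, hf.2, hg.2]⟩
  have smul : ∀ {f : Ω → ℝ} {m : ℝ} (c : ℝ), (Integrable f P ∧ ∫ ω, f ω ∂P = m) →
      (Integrable (fun ω => c * f ω) P ∧ ∫ ω, c * f ω ∂P = c * m) :=
    fun c hf => ⟨hf.1.const_mul c, by rw [integral_const_mul, hf.2]⟩
  have mul : ∀ {f g : Ω → ℝ} {m n : ℝ}, IndepFun f g P → (Integrable f P ∧ ∫ ω, f ω ∂P = m) →
      (Integrable g P ∧ ∫ ω, g ω ∂P = n) →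
      (Integrable (fun ω => f ω * g ω) P ∧ ∫ ω, f ω * g ω ∂P = m * n) :=
    fun hi hf hg => ⟨hi.integrable_mul hf.1 hg.1, by
      have := hi.integral_mul_eq_mul_integral hf.1.1 hg.1.1
      rw [← hf.2, ← hg.2]
      exact this⟩
  have hcos : ∀ k, Integrable (fun ω => Real.cos (φ i k ω)) P ∧
      ∫ ω, Real.cos (φ i k ω) ∂P = 0 := fun k =>
    ⟨((h.hasLaw_phase i k).map_eq ▸ integrable_uniformPhase
        Real.continuous_cos).comp_aemeasurable (h.hasLaw_phase i k).aemeasurable,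
      ((h.hasLaw_phase i k).integral_comp (f := Real.cos)
        Real.continuous_cos.aestronglyMeasurable).trans integral_cos_uniformPhase⟩
  have hsin : ∀ k, Integrable (fun ω => Real.sin (φ i k ω)) P ∧
      ∫ ω, Real.sin (φ i k ω) ∂P = 0 := fun k =>
    ⟨((h.hasLaw_phase i k).map_eq ▸ integrable_uniformPhase
        Real.continuous_sin).comp_aemeasurable (h.hasLaw_phase i k).aemeasurable,
      ((h.hasLaw_phase i k).integral_comp (f := Real.sin)
        Real.continuous_sin.aestronglyMeasurable).trans integral_sin_uniformPhase⟩
  have gauss : ∀ {G : Ω → ℝ}, HasLaw G (gaussianReal 0 (σ ^ 2).toNNReal) P →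
      (Integrable G P ∧ ∫ ω, G ω ∂P = 0) ∧
        (Integrable (fun ω => G ω ^ 2) P ∧ ∫ ω, G ω ^ 2 ∂P = σ ^ 2) := by
    intro G hG
    have hL : MemLp id 2 (P.map G) := by
      rw [hG.map_eq]
      exact memLp_id_gaussianReal 2
    have hL' : MemLp G 2 P := (memLp_map_measure_iff (by fun_prop) hG.aemeasurable).1 hL
    have hm : ∫ ω, G ω ∂P = 0 := by rw [hG.integral_eq, integral_id_gaussianReal]
    refine ⟨⟨hL'.integrable one_le_two, hm⟩, hL'.integrable_sq, ?_⟩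
    have := hG.variance_eq
    rw [variance_of_integral_eq_zero hG.aemeasurable hm, variance_id_gaussianReal] at this
    rw [this, Real.coe_toNNReal _ (sq_nonneg σ)]
  have ind : ∀ j k, j ≠ k → IndepFun
      (Sum.elim (fun p : Fin μ × Fin 2 => φ p.1 p.2) (Sum.elim X Y) j)
      (Sum.elim (fun p : Fin μ × Fin 2 => φ p.1 p.2) (Sum.elim X Y) k) P :=
    fun j k hjk => h.indep.indepFun hjk
  have i01 := ind (Sum.inl (i, 0)) (Sum.inl (i, 1)) (by simp)
  have iX : ∀ k, IndepFun (X i) (φ i k) P := fun k =>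
    ind (Sum.inr (Sum.inl i)) (Sum.inl (i, k)) (by simp)
  have iY : ∀ k, IndepFun (Y i) (φ i k) P := fun k =>
    ind (Sum.inr (Sum.inr i)) (Sum.inl (i, k)) (by simp)
  obtain ⟨gX, gX2⟩ := gauss (h.gaussian_X i)
  obtain ⟨gY, gY2⟩ := gauss (h.gaussian_Y i)
  have mc := Real.measurable_cos
  have ms := Real.measurable_sin
  have hc : Integrable (fun _ : Ω => (V i 0) ^ 2 + (V i 1) ^ 2) P ∧
      ∫ _ : Ω, (V i 0) ^ 2 + (V i 1) ^ 2 ∂P = (V i 0) ^ 2 + (V i 1) ^ 2 :=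
    ⟨integrable_const _, by simp⟩
  have total := add (add (add hc (smul (2 * V i 0 * V i 1)
      (add (mul (i01.comp mc mc) (hcos 0) (hcos 1)) (mul (i01.comp ms ms) (hsin 0) (hsin 1)))))
    (smul 2 (add
      (add (smul (V i 0) (mul ((iX 0).comp measurable_id mc) gX (hcos 0)))
        (smul (V i 1) (mul ((iX 1).comp measurable_id mc) gX (hcos 1))))
      (add (smul (V i 0) (mul ((iY 0).comp measurable_id ms) gY (hsin 0)))
        (smul (V i 1) (mul ((iY 1).comp measurable_id ms) gY (hsin 1)))))))
    (add gX2 gY2)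
  have hfun : (fun ω => ‖clusterAmplitude V φ X Y i ω‖ ^ 2) = fun ω =>
      (V i 0) ^ 2 + (V i 1) ^ 2 + 2 * V i 0 * V i 1 *
        (Real.cos (φ i 0 ω) * Real.cos (φ i 1 ω) + Real.sin (φ i 0 ω) * Real.sin (φ i 1 ω)) +
      2 * (V i 0 * (X i ω * Real.cos (φ i 0 ω)) + V i 1 * (X i ω * Real.cos (φ i 1 ω)) +
        (V i 0 * (Y i ω * Real.sin (φ i 0 ω)) + V i 1 * (Y i ω * Real.sin (φ i 1 ω)))) +
      (X i ω ^ 2 + Y i ω ^ 2) := by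
    ext ω
    rw [norm_sq_clusterAmplitude]
    have h1 := Real.sin_sq_add_cos_sq (φ i 0 ω)
    have h2 := Real.sin_sq_add_cos_sq (φ i 1 ω)
    linear_combination (V i 0) ^ 2 * h1 + (V i 1) ^ 2 * h2
  rw [hfun]
  refine ⟨total.1, total.2.trans (by ring)⟩

theorem IsFading.integral_power (h : IsFading P σ φ X Y) (V : Fin μ → Fin 2 → ℝ) :
    ∫ ω, power V φ X Y ω ∂P = specularPower V + 2 * σ ^ 2 * μ := by
  unfold power
  rw [integral_finsetSum _ fun i _ => (h.integral_cluster V i).1]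
  simp_rw [fun i => (h.integral_cluster V i).2]
  rw [Finset.sum_add_distrib, specularPower]
  simp [mul_comm]

/-! ### The product of cluster MGFs as an integral over a cube -/

theorem continuous_phaseFactor {N : ℕ} (Δ : Fin N → ℝ) : Continuous (phaseFactor Δ) := by
  unfold phaseFactor
  fun_prop

theorem volume_restrict_Icc_pi (N : ℕ) :
    (volume : Measure (Fin N → ℝ)).restrict (Set.Icc 0 fun _ => Real.pi) =
      Measure.pi fun _ : Fin N => (volume : Measure ℝ).restrict (Set.Icc 0 Real.pi) := by
  rw [← Measure.restrict_pi_pi, ← volume_pi, Set.pi_univ_Icc]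
  rfl

/-- The product of the cluster moment generating functions as an average over `[0, π]^N`. -/
theorem prod_clusterMGF {μ N : ℕ} (hN : N ≤ μ) {V : Fin μ → Fin 2 → ℝ}
    (hspec : 0 < specularPower V)
    (htail : ∀ i : Fin μ, N ≤ (i : ℕ) → V i 0 = 0 ∨ V i 1 = 0) (σ s : ℝ) :
    ∏ i, clusterMGF σ (V i 0) (V i 1) s =
      (Real.pi ^ N)⁻¹ * ∫ θ in Set.Icc (0 : Fin N → ℝ) (fun _ => Real.pi),
        ((1 - 2 * s * σ ^ 2)⁻¹) ^ μ * Real.exp (s * specularPower V *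
          phaseFactor (fun i => paramΔ V (Fin.castLE hN i)) θ / (1 - 2 * s * σ ^ 2)) := by
  set q := 1 - 2 * s * σ ^ 2 with hq
  have h1 : ∏ i, clusterMGF σ (V i 0) (V i 1) s =
      (q⁻¹) ^ μ * Real.exp (s * specularPower V / q) *
        ∏ i, (Real.pi⁻¹ * ∫ x in Set.Icc 0 Real.pi,
          Real.exp (2 * s * V i 0 * V i 1 / q * Real.cos x)) := by
    simp only [clusterMGF]
    rw [Finset.prod_mul_distrib, Finset.prod_mul_distrib, ← Real.exp_sum, ← Finset.sum_div,
      ← Finset.mul_sum]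
    simp [specularPower, hq]
  have h2 : ∏ i, (Real.pi⁻¹ * ∫ x in Set.Icc 0 Real.pi,
      Real.exp (2 * s * V i 0 * V i 1 / q * Real.cos x)) =
      ∏ j : Fin N, (Real.pi⁻¹ * ∫ x in Set.Icc 0 Real.pi,
        Real.exp (s * specularPower V / q * paramΔ V (Fin.castLE hN j) * Real.cos x)) := by
    -- Clusters outside the first `N` contribute the factor `1`: one amplitude vanishes, so the
    -- integrand is constantly `1`.
    symm
    refine Fintype.prod_of_injective (Fin.castLE hN) (Fin.castLE_injective hN) _ _ ?_ ?_
    · intro i hi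
      have hi' : N ≤ (i : ℕ) := by
        by_contra hlt
        exact hi ⟨⟨i, not_le.1 hlt⟩, rfl⟩
      have h0 : 2 * s * V i 0 * V i 1 / q = 0 := by
        rcases htail i hi' with h | h <;> simp [h]
      simp [h0, Real.pi_pos.le, Real.pi_ne_zero]
    · intro j
      have : s * specularPower V / q * paramΔ V (Fin.castLE hN j) =
          2 * s * V (Fin.castLE hN j) 0 * V (Fin.castLE hN j) 1 / q := by
        rw [paramΔ]
        field_simp
      simp_rw [this]
  rw [h1, h2, Finset.prod_mul_distrib, volume_restrict_Icc_pi,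
    ← integral_fintype_prod_eq_prod (f := fun (j : Fin N) x =>
      Real.exp (s * specularPower V / q * paramΔ V (Fin.castLE hN j) * Real.cos x)),
    integral_const_mul]
  simp_rw [← Real.exp_sum]
  have h3 : ∀ θ : Fin N → ℝ, s * specularPower V *
      phaseFactor (fun i => paramΔ V (Fin.castLE hN i)) θ / q = s * specularPower V / q +
      ∑ j, s * specularPower V / q * paramΔ V (Fin.castLE hN j) * Real.cos (θ j) := by
    intro θ
    simp_rw [mul_assoc, ← Finset.mul_sum, phaseFactor]
    ring
  simp_rw [h3, Real.exp_add]
  rw [integral_const_mul]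
  simp only [Finset.prod_const, Finset.card_univ, Fintype.card_fin, inv_pow]
  ring

/-! ### Poisson mixtures of gamma laws and their averages -/

theorem measurable_gammaPDF (a r : ℝ) : Measurable (gammaPDF a r) :=
  (measurable_gammaPDFReal a r).ennreal_ofReal

/-- Exponential tilting turns the gamma density of rate `r` into a multiple of the one of rate `r -
t`. -/
theorem lintegral_exp_mul_gammaPDF {a r t : ℝ} (ha : 0 < a) (hr : 0 < r) (ht : t < r) :
    ∫⁻ x, ENNReal.ofReal (Real.exp (t * x)) * gammaPDF a r x =
      ENNReal.ofReal ((r / (r - t)) ^ a) := by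
  have hrt : 0 < r - t := sub_pos.2 ht
  have key : ∀ x, ENNReal.ofReal (Real.exp (t * x)) * gammaPDF a r x =
      ENNReal.ofReal ((r / (r - t)) ^ a) * gammaPDF a (r - t) x := by
    intro x
    rw [gammaPDF, gammaPDF, ← ENNReal.ofReal_mul (by positivity),
      ← ENNReal.ofReal_mul (by positivity)]
    congr 1
    rw [gammaPDFReal, gammaPDFReal]
    split_ifs
    · have h1 : Real.exp (-((r - t) * x)) = Real.exp (t * x) * Real.exp (-(r * x)) := by
        rw [← Real.exp_add]; ring_nf
      rw [h1, Real.div_rpow hr.le hrt.le]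
      have : (r - t) ^ a ≠ 0 := (Real.rpow_pos_of_pos hrt a).ne'
      field_simp
    · simp
  simp_rw [key]
  rw [lintegral_const_mul _ (measurable_gammaPDF a (r - t)),
    lintegral_gammaPDF_eq_one ha hrt, mul_one]

/-- Density of a Poisson mixture of gamma laws, that is, of a scaled noncentral chi-squared law
with `2 n` degrees of freedom. -/
noncomputable def mixtureDensity (n : ℕ) (r L x : ℝ) : ENNReal :=
  ∑' k : ℕ, ENNReal.ofReal (Real.exp (-L) * (L ^ k / k.factorial)) * gammaPDF (k + n : ℕ) r x

theorem measurable_mixtureDensity (n : ℕ) (r : ℝ) :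
    Measurable fun p : ℝ × ℝ => mixtureDensity n r p.1 p.2 := by
  refine Measurable.tsum fun k => ?_
  have := measurable_gammaPDF (k + n : ℕ) r
  fun_prop

theorem measurable_mixtureDensity_comp {α : Type*} [MeasurableSpace α] (n : ℕ) (r : ℝ)
    {f g : α → ℝ} (hf : Measurable f) (hg : Measurable g) :
    Measurable fun a => mixtureDensity n r (f a) (g a) :=
  (measurable_mixtureDensity n r).comp (hf.prodMk hg)

theorem lintegral_exp_mul_mixtureDensity {n : ℕ} (hn : 0 < n) {r L t : ℝ} (hr : 0 < r)
    (hL : 0 ≤ L) (ht : t < r) :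
    ∫⁻ x, ENNReal.ofReal (Real.exp (t * x)) * mixtureDensity n r L x =
      ENNReal.ofReal ((r / (r - t)) ^ n * Real.exp (L * (r / (r - t) - 1))) := by
  have hrt : 0 < r - t := sub_pos.2 ht
  set ρ := r / (r - t)
  have hρ : 0 < ρ := by positivity
  simp_rw [mixtureDensity, ← ENNReal.tsum_mul_left]
  rw [lintegral_tsum fun k => by
    have := measurable_gammaPDF (k + n : ℕ) r
    fun_prop]
  -- The `k`-th gamma law contributes `ρ ^ (k + n)`, so the sum over `k` is the exponential series
  -- of `Lρ`.
  have h1 : ∀ k : ℕ, ∫⁻ x, ENNReal.ofReal (Real.exp (t * x)) *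
      (ENNReal.ofReal (Real.exp (-L) * (L ^ k / k.factorial)) * gammaPDF (k + n : ℕ) r x) =
      ENNReal.ofReal (Real.exp (-L) * ρ ^ n * ((L * ρ) ^ k / k.factorial)) := by
    intro k
    have hm := measurable_gammaPDF (k + n : ℕ) r
    simp_rw [mul_left_comm (ENNReal.ofReal (Real.exp (t * _)))]
    rw [lintegral_const_mul _ (by fun_prop), lintegral_exp_mul_gammaPDF
      (by exact_mod_cast Nat.add_pos_right k hn) hr ht, ← ENNReal.ofReal_mul (by positivity),
      Real.rpow_natCast]
    congr 1
    ring
  simp_rw [h1]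
  have hs := (Real.summable_pow_div_factorial (L * ρ)).mul_left (Real.exp (-L) * ρ ^ n)
  rw [← ENNReal.ofReal_tsum_of_nonneg (fun k => by positivity) hs, tsum_mul_left]
  have he : ∑' k : ℕ, (L * ρ) ^ k / (k.factorial : ℝ) = Real.exp (L * ρ) := by
    rw [Real.exp_eq_exp_ℝ, NormedSpace.exp_eq_tsum_div]
  rw [he, mul_sub, mul_one, sub_eq_neg_add, Real.exp_add]
  congr 1
  ring

/-- Termwise `2|ab| ≤ a² + b²`. This bound keeps the phase factor, hence the Poisson intensity,
nonnegative. -/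
theorem sum_paramΔ_le_one {μ N : ℕ} (hN : N ≤ μ) {V : Fin μ → Fin 2 → ℝ}
    (hspec : 0 < specularPower V) :
    ∑ j : Fin N, |paramΔ V (Fin.castLE hN j)| ≤ 1 := by
  calc ∑ j : Fin N, |paramΔ V (Fin.castLE hN j)|
      ≤ ∑ i : Fin μ, |paramΔ V i| := by
        have := Finset.sum_map Finset.univ (Fin.castLEEmb hN) (fun i => |paramΔ V i|)
        simp only [Fin.castLEEmb_apply] at this
        rw [← this]
        exact Finset.sum_le_univ_sum_of_nonneg fun i => abs_nonneg _
    _ ≤ ∑ i : Fin μ, ((V i 0) ^ 2 + (V i 1) ^ 2) / specularPower V := by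
        refine Finset.sum_le_sum fun i _ => ?_
        rw [paramΔ, abs_div, abs_of_pos hspec]
        gcongr
        rw [abs_le]
        constructor <;> nlinarith [sq_nonneg (V i 0 - V i 1), sq_nonneg (V i 0 + V i 1)]
    _ = 1 := by rw [← Finset.sum_div]; exact div_self hspec.ne'

theorem phaseFactor_nonneg {N : ℕ} {Δ : Fin N → ℝ} (hΔ : ∑ i, |Δ i| ≤ 1) (θ : Fin N → ℝ) :
    0 ≤ phaseFactor Δ θ := by
  have : -(∑ i, |Δ i|) ≤ ∑ i, Δ i * Real.cos (θ i) := by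
    rw [← Finset.sum_neg_distrib]
    refine Finset.sum_le_sum fun i _ => ?_
    have h := abs_mul (Δ i) (Real.cos (θ i))
    have h2 := mul_le_of_le_one_right (abs_nonneg (Δ i)) (Real.abs_cos_le_one (θ i))
    have h3 := neg_abs_le (Δ i * Real.cos (θ i))
    linarith
  rw [phaseFactor]
  linarith

/-- Average over `[0, π]^N` of the Poisson mixture densities with intensity `κ` times the phase
factor. -/
noncomputable def averagedDensity (n : ℕ) (r κ : ℝ) {N : ℕ} (Δ : Fin N → ℝ) (x : ℝ) : ENNReal :=
  ENNReal.ofReal (Real.pi ^ N)⁻¹ * ∫⁻ θ in Set.Icc (0 : Fin N → ℝ) (fun _ => Real.pi),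
    mixtureDensity n r (κ * phaseFactor Δ θ) x

theorem measurable_averagedDensity (n : ℕ) (r κ : ℝ) {N : ℕ} (Δ : Fin N → ℝ) :
    Measurable (averagedDensity n r κ Δ) := by
  refine Measurable.const_mul ?_ _
  exact Measurable.lintegral_prod_left' (f := fun p : (Fin N → ℝ) × ℝ =>
    mixtureDensity n r (κ * phaseFactor Δ p.1) p.2) (measurable_mixtureDensity_comp n r
      (((continuous_phaseFactor Δ).measurable.comp measurable_fst).const_mul κ) measurable_snd)

theorem lintegral_exp_mul_averagedDensity {n : ℕ} (hn : 0 < n) {r κ t : ℝ} (hr : 0 < r)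
    (hκ : 0 ≤ κ) (ht : t < r) {N : ℕ} {Δ : Fin N → ℝ} (hΔ : ∑ i, |Δ i| ≤ 1) :
    ∫⁻ x, ENNReal.ofReal (Real.exp (t * x)) * averagedDensity n r κ Δ x =
      ENNReal.ofReal ((Real.pi ^ N)⁻¹ * ∫ θ in Set.Icc (0 : Fin N → ℝ) (fun _ => Real.pi),
        (r / (r - t)) ^ n * Real.exp (κ * phaseFactor Δ θ * (r / (r - t) - 1))) := by
  have hrt : 0 < r - t := sub_pos.2 ht
  have hpf := (continuous_phaseFactor Δ)
  have hjm : Measurable fun p : ℝ × (Fin N → ℝ) => ENNReal.ofReal (Real.exp (t * p.1)) *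
      mixtureDensity n r (κ * phaseFactor Δ p.2) p.1 := by
    exact Measurable.mul (by fun_prop) (measurable_mixtureDensity_comp n r
      ((hpf.measurable.comp measurable_snd).const_mul κ) measurable_fst)
  have h1 : ∀ x, ENNReal.ofReal (Real.exp (t * x)) *
      ∫⁻ θ in Set.Icc (0 : Fin N → ℝ) (fun _ => Real.pi),
        mixtureDensity n r (κ * phaseFactor Δ θ) x =
      ∫⁻ θ in Set.Icc (0 : Fin N → ℝ) (fun _ => Real.pi), ENNReal.ofReal (Real.exp (t * x)) *
        mixtureDensity n r (κ * phaseFactor Δ θ) x :=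
    fun x => (lintegral_const_mul' _ _ ENNReal.ofReal_ne_top).symm
  have h2 : ∀ x, ENNReal.ofReal (Real.exp (t * x)) * averagedDensity n r κ Δ x =
      ENNReal.ofReal (Real.pi ^ N)⁻¹ * ∫⁻ θ in Set.Icc (0 : Fin N → ℝ) (fun _ => Real.pi),
        ENNReal.ofReal (Real.exp (t * x)) * mixtureDensity n r (κ * phaseFactor Δ θ) x := by
    intro x
    rw [averagedDensity, mul_left_comm, h1]
  rw [lintegral_congr h2, lintegral_const_mul' _ _ ENNReal.ofReal_ne_top,
    ENNReal.ofReal_mul (by positivity)]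
  congr 1
  rw [lintegral_lintegral_swap hjm.aemeasurable]
  simp_rw [fun θ => lintegral_exp_mul_mixtureDensity hn hr
    (mul_nonneg hκ (phaseFactor_nonneg hΔ θ)) ht]
  rw [ofReal_integral_eq_lintegral_ofReal]
  · exact ContinuousOn.integrableOn_compact isCompact_Icc (by fun_prop)
  · exact ae_of_all _ fun θ => by positivity

/-! ### Identification of the law of the SNR -/

theorem IsFading.aemeasurable_power (h : IsFading P σ φ X Y) (V : Fin μ → Fin 2 → ℝ) :
    AEMeasurable (power V φ X Y) P :=
  Finset.aemeasurable_fun_sum _ fun i _ => (h.integral_cluster V i).1.aemeasurable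

theorem IsFading.aemeasurable_snr (h : IsFading P σ φ X Y) (V : Fin μ → Fin 2 → ℝ) (Es N0 : ℝ) :
    AEMeasurable (snr V φ X Y Es N0) P :=
  ((h.aemeasurable_power V).mul_const Es).div_const N0

/-- The law of the received SNR. -/
theorem IsFading.map_snr (h : IsFading P σ φ X Y) (hσ : 0 < σ) {V : Fin μ → Fin 2 → ℝ}
    (hspec : 0 < specularPower V) {Es N0 : ℝ} (hEs : 0 < Es) (hN0 : 0 < N0) {N : ℕ} (hN : N ≤ μ)
    (htail : ∀ i : Fin μ, N ≤ (i : ℕ) → V i 0 = 0 ∨ V i 1 = 0) (hμ : 0 < μ) :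
    P.map (snr V φ X Y Es N0) = volume.withDensity
      (averagedDensity μ (2 * σ ^ 2 * (Es / N0))⁻¹ (μ * paramK V σ)
        fun i => paramΔ V (Fin.castLE hN i)) := by
  set c := Es / N0 with hc
  have hc0 : 0 < c := by positivity
  set r := (2 * σ ^ 2 * c)⁻¹ with hr
  have hr0 : 0 < r := by positivity
  set Δ : Fin N → ℝ := fun i => paramΔ V (Fin.castLE hN i)
  have hΔ : ∑ i, |Δ i| ≤ 1 := sum_paramΔ_le_one hN hspec
  have hμ' : (0 : ℝ) < μ := by exact_mod_cast hμ
  have hK : 0 ≤ (μ : ℝ) * paramK V σ := by rw [paramK]; positivity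
  set ν := volume.withDensity (averagedDensity μ r (μ * paramK V σ) Δ) with hν
  have hlint : ∀ t < r, ∫⁻ x, ENNReal.ofReal (Real.exp (t * id x)) ∂ν =
      ENNReal.ofReal (∏ i, clusterMGF σ (V i 0) (V i 1) (c * t)) := by
    intro t ht
    rw [hν, lintegral_withDensity_eq_lintegral_mul _ (measurable_averagedDensity _ _ _ _)
      (by fun_prop)]
    simp_rw [Pi.mul_apply, mul_comm (averagedDensity _ _ _ _ _)]
    -- Scaling the power by `c` puts the singularity `q = 0` of the MGF at `t = r`, the rate of the
    -- gamma laws.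
    have hq : 1 - 2 * (c * t) * σ ^ 2 = (r - t) / r := by rw [hr]; field_simp
    have hrt : r - t ≠ 0 := (sub_pos.2 ht).ne'
    rw [prod_clusterMGF hN hspec htail]
    refine (lintegral_exp_mul_averagedDensity hμ hr0 hK ht hΔ).trans ?_
    rw [hq, inv_div]
    congr 4
    ext θ
    congr 2
    -- Since `μK = S c r` with `S` the specular power, both exponents equal `c t S Λ(θ) r / (r -
    -- t)`.
    rw [paramK, show r / (r - t) - 1 = t / (r - t) by field_simp; ring]
    have : r = (2 * σ ^ 2 * c)⁻¹ := hr
    field_simp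
    rw [this]
    field_simp
    exact mul_comm _ _
  have hqpos : ∀ t < r, 0 < 1 - 2 * (c * t) * σ ^ 2 := by
    intro t ht
    have hq : 1 - 2 * (c * t) * σ ^ 2 = (r - t) / r := by rw [hr]; field_simp
    rw [hq]
    exact div_pos (sub_pos.2 ht) hr0
  have hpos : ∀ t < r, 0 < ∏ i, clusterMGF σ (V i 0) (V i 1) (c * t) := fun t ht =>
    Finset.prod_pos fun i _ => clusterMGF_pos (hqpos t ht) _ _
  have hsnr : snr V φ X Y Es N0 = fun ω => c * power V φ X Y ω := by
    ext ω
    rw [snr, hc]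
    ring
  have hmgf : ∀ t < r, mgf (snr V φ X Y Es N0) P t =
      ∏ i, clusterMGF σ (V i 0) (V i 1) (c * t) := by
    intro t ht
    rw [← h.mgf_power hσ (hqpos t ht) V, hsnr, mgf_const_mul]
  have hνm : ∀ t < r, t ∈ integrableExpSet id ν ∧ mgf id ν t =
      ∏ i, clusterMGF σ (V i 0) (V i 1) (c * t) := fun t ht =>
    integrable_exp_and_mgf_of_lintegral aemeasurable_id (hpos t ht) (hlint t ht)
  -- The MGF identity at `t = 0` gives the total mass.
  have : IsFiniteMeasure ν := by
    refine ⟨?_⟩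
    have := hlint 0 hr0
    simp only [zero_mul, Real.exp_zero, ENNReal.ofReal_one, lintegral_one] at this
    rw [this]
    exact ENNReal.ofReal_lt_top
  rw [← Measure.map_id (μ := ν)]
  refine map_eq_map_of_mgf_eq_of_lt (h.aemeasurable_snr V Es N0) aemeasurable_id hr0 ?_
    (fun t ht => (hνm t ht).1) (fun t ht => (hmgf t ht).trans (hνm t ht).2.symm)
  intro t ht
  by_contra hni
  exact (hpos t ht).ne' ((hmgf t ht).symm.trans (integral_undef hni))

/-! ### Summing the mixture to a Bessel function -/

/-- The entire function `∑ k, y ^ k / (k! (k + n)!)` underlying `besselI n`. -/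
noncomputable def besselSeries (n : ℕ) (y : ℝ) : ℝ :=
  ∑' k : ℕ, y ^ k / ((k.factorial : ℝ) * ((k + n).factorial : ℝ))

theorem norm_besselSeries_term_le (n k : ℕ) {y M : ℝ} (hy : |y| ≤ M) :
    ‖y ^ k / ((k.factorial : ℝ) * ((k + n).factorial : ℝ))‖ ≤ M ^ k / k.factorial := by
  have h1 : (1 : ℝ) ≤ (k + n).factorial := by exact_mod_cast Nat.factorial_pos _
  have h2 : (0 : ℝ) < k.factorial := by exact_mod_cast Nat.factorial_pos _
  rw [norm_div, norm_pow, Real.norm_eq_abs, Real.norm_of_nonneg (by positivity)]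
  have hM : 0 ≤ M := (abs_nonneg y).trans hy
  exact div_le_div₀ (by positivity) (by gcongr) h2 (le_mul_of_one_le_right h2.le h1)

theorem summable_besselSeries (n : ℕ) (y : ℝ) :
    Summable fun k : ℕ => y ^ k / ((k.factorial : ℝ) * ((k + n).factorial : ℝ)) :=
  Summable.of_norm_bounded (Real.summable_pow_div_factorial |y|)
    fun k => norm_besselSeries_term_le n k le_rfl

theorem continuous_besselSeries (n : ℕ) : Continuous (besselSeries n) := by
  refine continuous_iff_continuousAt.2 fun y => ?_
  have : ContinuousOn (besselSeries n) (Metric.closedBall 0 (|y| + 1)) :=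
    continuousOn_tsum (fun k => by fun_prop) (Real.summable_pow_div_factorial (|y| + 1))
      fun k x hx => norm_besselSeries_term_le n k (by simpa using hx)
  exact this.continuousAt (Metric.closedBall_mem_nhds_of_mem (by simp))

theorem besselSeries_nonneg (n : ℕ) {y : ℝ} (hy : 0 ≤ y) : 0 ≤ besselSeries n y :=
  tsum_nonneg fun k => by positivity

theorem besselI_eq_besselSeries (n : ℕ) (z : ℝ) :
    besselI n z = (z / 2) ^ n * besselSeries n ((z / 2) ^ 2) := by
  rw [besselI, besselSeries, ← tsum_mul_left]
  congr 1
  ext k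
  rw [pow_add, pow_mul]
  ring

theorem rpow_natCast_div_two {y : ℝ} (hy : 0 ≤ y) (n : ℕ) : y ^ ((n : ℝ) / 2) = √y ^ n := by
  rw [Real.sqrt_eq_rpow, ← Real.rpow_natCast, ← Real.rpow_mul hy]
  congr 1
  ring

/-- With `μ = n + 1`, the gamma normalisation `Γ(k + μ) = (k + n)!` is the second factorial in the
series of `I_n`. -/
theorem mixtureDensity_eq {n : ℕ} {r L x : ℝ} (hr : 0 < r) (hL : 0 ≤ L) (hx : 0 ≤ x) :
    mixtureDensity (n + 1) r L x = ENNReal.ofReal (Real.exp (-L) * Real.exp (-(r * x)) *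
      r ^ (n + 1) * x ^ n * besselSeries n (r * L * x)) := by
  rw [besselSeries, ← tsum_mul_left, ENNReal.ofReal_tsum_of_nonneg (fun k => by positivity)
    ((summable_besselSeries n _).mul_left _), mixtureDensity]
  congr 1
  ext k
  rw [gammaPDF_of_nonneg hx, ← ENNReal.ofReal_mul (by positivity)]
  congr 1
  have h1 : ((k + (n + 1) : ℕ) : ℝ) - 1 = ((k + n : ℕ) : ℝ) := by push_cast; ring
  have h2 : Real.Gamma ((k + (n + 1) : ℕ) : ℝ) = (k + n).factorial := by
    rw [← add_assoc, Nat.cast_add_one, Real.Gamma_nat_eq_factorial]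
  rw [h1, h2, Real.rpow_natCast, Real.rpow_natCast]
  have h3 : ((k + n).factorial : ℝ) ≠ 0 := by exact_mod_cast Nat.factorial_ne_zero _
  field_simp
  ring

theorem mixtureDensity_of_neg {n : ℕ} {r L x : ℝ} (hx : x < 0) : mixtureDensity n r L x = 0 := by
  simp [mixtureDensity, gammaPDF_of_neg hx]

theorem averagedDensity_of_neg {n N : ℕ} {r κ x : ℝ} (Δ : Fin N → ℝ) (hx : x < 0) :
    averagedDensity n r κ Δ x = 0 := by
  simp [averagedDensity, mixtureDensity_of_neg hx]

/-- The phase factor vanishes only on a null set of `[0, π]^N`. -/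
theorem ae_phaseFactor_pos {N : ℕ} {Δ : Fin N → ℝ} (hΔ : ∑ i, |Δ i| ≤ 1) (h0 : ∀ i, 0 ≤ Δ i) :
    ∀ᵐ θ ∂(volume : Measure (Fin N → ℝ)).restrict (Set.Icc 0 fun _ => Real.pi),
      0 < phaseFactor Δ θ := by
  by_cases hz : ∃ i, Δ i ≠ 0
  · obtain ⟨i, hi⟩ := hz
    have hnull : ∀ᵐ θ ∂(volume : Measure (Fin N → ℝ)).restrict (Set.Icc 0 fun _ => Real.pi),
        θ i ≠ Real.pi := ae_restrict_of_ae (by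
          rw [volume_pi]
          exact Measure.ae_eval_ne (α := fun _ : Fin N => ℝ) (fun _ => volume) i Real.pi)
    filter_upwards [hnull, ae_restrict_mem measurableSet_Icc] with θ hθ hmem
    -- If the phase factor is `0`, then `∑ Δ_j (1 + cos θ_j) = ∑ Δ_j - 1 ≤ 0`; all its terms are
    -- nonnegative, so each vanishes and `θ i = π`.
    refine (phaseFactor_nonneg hΔ θ).lt_of_ne' fun hpf => hθ ?_
    simp_rw [fun i => abs_of_nonneg (h0 i)] at hΔ
    have hnn : ∀ j, 0 ≤ Δ j * (1 + Real.cos (θ j)) := fun j =>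
      mul_nonneg (h0 j) (by linarith [Real.neg_one_le_cos (θ j)])
    have hsum : ∑ j, Δ j * (1 + Real.cos (θ j)) ≤ 0 := by
      simp_rw [mul_add, mul_one]
      rw [Finset.sum_add_distrib]
      rw [phaseFactor] at hpf
      linarith
    have hle := (Finset.single_le_sum (fun j _ => hnn j) (Finset.mem_univ i)).trans hsum
    have hcos : Real.cos (θ i) = Real.cos Real.pi := by
      have := (mul_eq_zero.1 (le_antisymm hle (hnn i))).resolve_left hi
      rw [Real.cos_pi]
      linarith
    exact Real.injOn_cos ⟨hmem.1 i, hmem.2 i⟩ ⟨Real.pi_pos.le, le_rfl⟩ hcos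
  · push Not at hz
    simp [phaseFactor, hz]

/-- The power `Λ^(-n/2)` cancels the factor `√Λ ^ n` pulled out of the Bessel function, so the
singularity at `Λ = 0` is removable. At `Λ = 0` itself the default value of `rpow` can break the
equality, hence the strict hypothesis and the almost-everywhere arguments that follow. -/
theorem pdfIntegrand_eq {n N : ℕ} {K g r x : ℝ} {Δ : Fin N → ℝ} {θ : Fin N → ℝ} (hK : 0 ≤ K)
    (hr : 0 < r) (hg : (1 + K) / g = r / (n + 1 : ℕ)) (hx : 0 ≤ x)
    (hpf : 0 < phaseFactor Δ θ) :
    pdfIntegrand (n + 1) K g Δ x θ = Real.exp ((n + 1 : ℕ) * K) *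
      √(r * (n + 1 : ℕ) * K * x) ^ n * (Real.exp (-((n + 1 : ℕ) * K * phaseFactor Δ θ)) *
        besselSeries n (r * ((n + 1 : ℕ) * K * phaseFactor Δ θ) * x)) := by
  have hm : (0 : ℝ) < (n + 1 : ℕ) := by positivity
  have he : (1 - ((n + 1 : ℕ) : ℝ)) / 2 = -((n : ℝ) / 2) := by push_cast; ring
  rw [pdfIntegrand, hg, besselI_eq_besselSeries, he, Real.rpow_neg hpf.le,
    rpow_natCast_div_two hpf.le, Nat.add_sub_cancel]
  generalize hmd : ((n + 1 : ℕ) : ℝ) = m at *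
  have hz : 2 * m * √(r / m * K * phaseFactor Δ θ * x) / 2 =
      √(phaseFactor Δ θ) * √(r * m * K * x) := by
    rw [← Real.sqrt_mul hpf.le, show phaseFactor Δ θ * (r * m * K * x) =
      m ^ 2 * (r / m * K * phaseFactor Δ θ * x) by field_simp,
      Real.sqrt_mul (sq_nonneg m), Real.sqrt_sq hm.le]
    ring
  rw [hz, mul_pow (√_) (√_) 2, Real.sq_sqrt hpf.le, Real.sq_sqrt (by positivity), mul_pow]
  have hs : √(phaseFactor Δ θ) ^ n ≠ 0 := pow_ne_zero _ (Real.sqrt_pos.2 hpf).ne'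
  have hexp : Real.exp (-(m * K * ∑ i, Δ i * Real.cos (θ i))) =
      Real.exp (m * K) * Real.exp (-(m * K * phaseFactor Δ θ)) := by
    rw [← Real.exp_add, phaseFactor]
    congr 1
    ring
  rw [hexp, show phaseFactor Δ θ * (r * m * K * x) = r * (m * K * phaseFactor Δ θ) * x by ring]
  field_simp

/-- The half-integer powers combine through `√(r/m) √(x/K) √(rmKx) = rx`, so `K` disappears. -/
theorem pdf_prefactor_eq {n N : ℕ} {K r x : ℝ} (hK : 0 < K) (hr : 0 < r) (hx : 0 ≤ x) :
    ((n + 1 : ℕ) : ℝ) / Real.pi ^ N * (r / (n + 1 : ℕ)) ^ ((((n + 1 : ℕ) : ℝ) + 1) / 2) *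
        Real.exp (-((n + 1 : ℕ) * K)) * (x / K) ^ ((((n + 1 : ℕ) : ℝ) - 1) / 2) *
        Real.exp (-((n + 1 : ℕ) * (r / (n + 1 : ℕ)) * x)) *
      (Real.exp ((n + 1 : ℕ) * K) * √(r * (n + 1 : ℕ) * K * x) ^ n) =
      (Real.pi ^ N)⁻¹ * (Real.exp (-(r * x)) * r ^ (n + 1) * x ^ n) := by
  have hm : (0 : ℝ) < (n + 1 : ℕ) := by positivity
  have h1 : (((n + 1 : ℕ) : ℝ) + 1) / 2 = (n : ℝ) / 2 + 1 := by push_cast; ring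
  have h2 : (((n + 1 : ℕ) : ℝ) - 1) / 2 = (n : ℝ) / 2 := by push_cast; ring
  rw [h1, h2]
  generalize ((n + 1 : ℕ) : ℝ) = m at *
  rw [Real.rpow_add_one (by positivity), rpow_natCast_div_two (by positivity),
    rpow_natCast_div_two (by positivity), Real.exp_neg (m * K)]
  have h3 : √(r / m) * √(x / K) * √(r * m * K * x) = r * x := by
    rw [← Real.sqrt_mul (by positivity), ← Real.sqrt_mul (by positivity),
      show r / m * (x / K) * (r * m * K * x) = (r * x) ^ 2 by field_simp,
      Real.sqrt_sq (by positivity)]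
  have h4 : √(r / m) ^ n * √(x / K) ^ n * √(r * m * K * x) ^ n = r ^ n * x ^ n := by
    rw [← mul_pow, ← mul_pow, h3, mul_pow]
  have hmr : m * (r / m) = r := by field_simp
  have hexp : Real.exp (m * K) ≠ 0 := (Real.exp_pos _).ne'
  rw [hmr]
  calc _ = (Real.pi ^ N)⁻¹ * (Real.exp (-(r * x)) * (m * (r / m)) *
        (√(r / m) ^ n * √(x / K) ^ n * √(r * m * K * x) ^ n)) *
        ((Real.exp (m * K))⁻¹ * Real.exp (m * K)) := by ring
    _ = _ := by rw [hmr, h4, inv_mul_cancel₀ hexp]; ring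

theorem integrableOn_pdfIntegrand {n N : ℕ} {K g r x : ℝ} {Δ : Fin N → ℝ} (hK : 0 ≤ K)
    (hr : 0 < r) (hg : (1 + K) / g = r / (n + 1 : ℕ)) (hx : 0 ≤ x)
    (hΔ : ∑ i, |Δ i| ≤ 1) (h0 : ∀ i, 0 ≤ Δ i) :
    IntegrableOn (pdfIntegrand (n + 1) K g Δ x) (Set.Icc 0 (fun _ => Real.pi)) volume := by
  have hcont := continuous_phaseFactor Δ
  have hb := continuous_besselSeries n
  refine IntegrableOn.congr_fun_ae (f := fun θ => Real.exp ((n + 1 : ℕ) * K) *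
      √(r * (n + 1 : ℕ) * K * x) ^ n * (Real.exp (-((n + 1 : ℕ) * K * phaseFactor Δ θ)) *
        besselSeries n (r * ((n + 1 : ℕ) * K * phaseFactor Δ θ) * x))) ?_ ?_
  · exact ContinuousOn.integrableOn_compact isCompact_Icc (by fun_prop)
  · filter_upwards [ae_phaseFactor_pos hΔ h0] with θ hθ
    exact (pdfIntegrand_eq hK hr hg hx hθ).symm

theorem toReal_averagedDensity {n N : ℕ} {K g r x : ℝ} {Δ : Fin N → ℝ} (hK : 0 < K)
    (hr : 0 < r) (hg : (1 + K) / g = r / (n + 1 : ℕ)) (hx : 0 ≤ x)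
    (hΔ : ∑ i, |Δ i| ≤ 1) (h0 : ∀ i, 0 ≤ Δ i) :
    (averagedDensity (n + 1) r ((n + 1 : ℕ) * K) Δ x).toReal = pdfFormula (n + 1) K g Δ x := by
  have hcont := continuous_phaseFactor Δ
  have hb := continuous_besselSeries n
  have hL : ∀ θ, 0 ≤ ((n + 1 : ℕ) : ℝ) * K * phaseFactor Δ θ := fun θ =>
    mul_nonneg (by positivity) (phaseFactor_nonneg hΔ θ)
  have hint : ∫ θ in Set.Icc (0 : Fin N → ℝ) (fun _ => Real.pi),
      pdfIntegrand (n + 1) K g Δ x θ = ∫ θ in Set.Icc (0 : Fin N → ℝ) (fun _ => Real.pi),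
      Real.exp ((n + 1 : ℕ) * K) *
      √(r * (n + 1 : ℕ) * K * x) ^ n * (Real.exp (-((n + 1 : ℕ) * K * phaseFactor Δ θ)) *
        besselSeries n (r * ((n + 1 : ℕ) * K * phaseFactor Δ θ) * x)) := by
    refine integral_congr_ae ?_
    filter_upwards [ae_phaseFactor_pos hΔ h0] with θ hθ
    exact pdfIntegrand_eq hK.le hr hg hx hθ
  rw [pdfFormula, hint, integral_const_mul, ← mul_assoc, hg, pdf_prefactor_eq hK hr hx,
    averagedDensity, ENNReal.toReal_mul, ENNReal.toReal_ofReal (by positivity), mul_assoc,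
    ← integral_const_mul]
  congr 1
  simp_rw [fun θ => mixtureDensity_eq (n := n) hr (hL θ) hx]
  rw [← integral_eq_lintegral_of_nonneg_ae]
  · congr 1
    ext θ
    ring
  · refine ae_of_all _ fun θ => ?_
    have := besselSeries_nonneg n (y := r * ((n + 1 : ℕ) * K * phaseFactor Δ θ) * x)
      (mul_nonneg (mul_nonneg hr.le (hL θ)) hx)
    simp only [Pi.zero_apply]
    positivity
  · exact Continuous.aestronglyMeasurable (by fun_prop)

end MTW

/-! ### The density formula -/

open MTW in
theorem lemma1 {Ω : Type*} [MeasurableSpace Ω] (P : Measure Ω) [IsProbabilityMeasure P]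
    (μ : ℕ) (V : Fin μ → Fin 2 → ℝ) (hV : ∀ i k, 0 ≤ V i k)
    (hspec : 0 < MTW.specularPower V)
    (σ : ℝ) (hσ : 0 < σ) (Es N0 : ℝ) (hEs : 0 < Es) (hN0 : 0 < N0)
    (φ : Fin μ → Fin 2 → Ω → ℝ) (X Y : Fin μ → Ω → ℝ)
    (hfading : MTW.IsFading P σ φ X Y)
    (N : ℕ) (hN : N ≤ μ) (htail : ∀ i : Fin μ, N ≤ (i : ℕ) → V i 0 = 0 ∨ V i 1 = 0) :
    let γ : Ω → ℝ := MTW.snr V φ X Y Es N0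
    let g : ℝ := ∫ ω, γ ω ∂P
    let K : ℝ := MTW.paramK V σ
    let Δ : Fin N → ℝ := fun i => MTW.paramΔ V (Fin.castLE hN i)
    (∀ x : ℝ, 0 ≤ x →
      IntegrableOn (MTW.pdfIntegrand μ K g Δ x) (Set.Icc 0 (fun _ => Real.pi)) volume) ∧
    HasPDF γ P volume ∧
    (∀ᵐ x : ℝ, (pdf γ P volume x).toReal =
      Set.indicator (Set.Ici 0) (MTW.pdfFormula μ K g Δ) x) := by
  intro γ g K Δ
  -- Positive specular power excludes `μ = 0`; writing `μ = n + 1` makes the truncated subtraction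
  -- `μ - 1` equal to `n`.
  obtain ⟨n, rfl⟩ : ∃ n, μ = n + 1 := Nat.exists_eq_succ_of_ne_zero fun h => by
    subst h
    simp [specularPower] at hspec
  set r := (2 * σ ^ 2 * (Es / N0))⁻¹ with hr
  have hr0 : 0 < r := by positivity
  have hm : (0 : ℝ) < (n + 1 : ℕ) := by positivity
  have hK : K = specularPower V / (2 * σ ^ 2 * (n + 1 : ℕ)) := rfl
  have hK0 : 0 < K := by rw [hK]; positivity
  have hΔ : ∑ i, |Δ i| ≤ 1 := sum_paramΔ_le_one hN hspec
  have h0 : ∀ i, 0 ≤ Δ i := fun i =>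
    div_nonneg (mul_nonneg (mul_nonneg zero_le_two (hV _ _)) (hV _ _)) hspec.le
  have hgv : g = (specularPower V + 2 * σ ^ 2 * (n + 1 : ℕ)) * Es / N0 := by
    rw [← hfading.integral_power V, ← integral_mul_const, ← integral_div]
    rfl
  -- The mean is `g = 2σ²μ(1+K) Es/N0`, which ties the gamma rate to the average SNR.
  have hg : (1 + K) / g = r / (n + 1 : ℕ) := by
    rw [hgv, hK, hr]
    have : specularPower V + 2 * σ ^ 2 * (n + 1 : ℕ) ≠ 0 := by positivity
    field_simp
    ring
  have hmap := hfading.map_snr hσ hspec hEs hN0 hN htail n.succ_pos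
  have hmeas := measurable_averagedDensity (n + 1) r ((n + 1 : ℕ) * K) Δ
  have hpdf : HasPDF γ P volume := hasPDF_of_map_eq_withDensity
    (hfading.aemeasurable_snr V Es N0) _ hmeas.aemeasurable hmap
  refine ⟨fun x hx => integrableOn_pdfIntegrand hK0.le hr0 hg hx hΔ h0, hpdf, ?_⟩
  filter_upwards [pdf.eq_of_map_eq_withDensity' _ hmeas.aemeasurable |>.1 hmap] with x hx
  rw [hx]
  by_cases hx0 : 0 ≤ x
  · rw [Set.indicator_of_mem (Set.mem_Ici.2 hx0)]
    exact toReal_averagedDensity hK0 hr0 hg hx0 hΔ h0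
  · rw [Set.indicator_of_notMem (by simpa using hx0), averagedDensity_of_neg Δ (not_le.1 hx0)]
    rfl
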